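/- For an infinite word $u=u_0u_1u_2\cdots$ over a finite alphabet, let $\mathcal L(u)$ be the set of its finite factors and let $\mathcal C_u(n)$ be the number of its factors of length $n$. For a finite word $w$ of length $|w|$, the $R$-defect is $D^R(w)=|w|+1-\#\mathrm{Pal}^R(w)$, where $\mathrm{Pal}^R(w)$ is the set of palindromic factors of $w$, including the empty word; the word $u$ is called $R$-rich if $D^R(u)=\sup\{D^R(w): w\in\mathcal L(u)\}$ equals $0$. For $b\ge 2$ let $t_{b,2}=(s_b(n)\bmod 2)_{n\ge 0}$, where $s_b(n)$ is the sum of the digits of $n$ in base $b$, and for $u\in\{0,1\}^{\mathbb N}$ let $S(u)=v_1v_2v_3\cdots$ with $v_i=(u_{i-1}+u_i)\bmod 2$ for $i\ge 1$. Then for every integer $b\ge 2$ the word $v=S(t_{b,2})$ is $R$-rich, and its factor complexity satisfies $$\mathcal C_v(n)=\tfrac12\,\mathcal C_{t_{b,2}}(n+1)\qquad\text{for all } n\ge 0 .$$ -/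

import Mathlib

/-- The finite word `u_i u_{i+1} ⋯ u_{i+n-1}` read in the infinite word `u`. -/
def factorAt {A : Type*} (u : ℕ → A) (i n : ℕ) : List A :=
  List.ofFn fun k : Fin n => u (i + k)

/-- The set of all factors of length `n` of the infinite word `u`. -/
def factorsOfLength {A : Type*} (u : ℕ → A) (n : ℕ) : Set (List A) :=
  {w | ∃ i : ℕ, w = factorAt u i n}

/-- The language of `u`: the set of all its (finite) factors. -/
def wordLanguage {A : Type*} (u : ℕ → A) : Set (List A) :=
  {w | ∃ n : ℕ, w ∈ factorsOfLength u n}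

/-- The factor complexity of an infinite word over a finite alphabet. -/
noncomputable def factorComplexity {A : Type*} [Finite A] (u : ℕ → A) (n : ℕ) : ℕ :=
  (factorsOfLength u n).ncard

/-- Over a finite alphabet there are only finitely many factors of each length, so that
`factorComplexity` is a genuine count. -/
theorem factorsOfLength_finite {A : Type*} [Finite A] (u : ℕ → A) (n : ℕ) :
    (factorsOfLength u n).Finite := by
  refine (Set.finite_range (fun f : Fin n → A => List.ofFn f)).subset ?_
  rintro w ⟨i, rfl⟩
  exact ⟨fun k => u (i + k), rfl⟩

/-- The set of palindromic factors (the empty word included) of a finite word `w`. -/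
def palindromicFactors {A : Type*} (w : List A) : Set (List A) :=
  {p | p <:+: w ∧ p.reverse = p}

/-- A finite word has only finitely many palindromic factors, so that their `ncard` is a
genuine count. -/
theorem palindromicFactors_finite {A : Type*} (w : List A) :
    (palindromicFactors w).Finite := by
  refine (List.finite_toSet w.sublists).subset ?_
  rintro p ⟨hp, -⟩
  exact List.mem_sublists.mpr hp.sublist

/-- The `R`-defect of a finite word: its length plus one minus the number of its
palindromic factors. -/
noncomputable def finiteDefect {A : Type*} (w : List A) : ℤ :=
  (w.length : ℤ) + 1 - ((palindromicFactors w).ncard : ℤ)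

/-- The `R`-defect of an infinite word: the supremum (possibly infinite) of the
`R`-defects of its factors. -/
noncomputable def wordDefect {A : Type*} (u : ℕ → A) : EReal :=
  ⨆ w ∈ wordLanguage u, ((finiteDefect w : ℝ) : EReal)

/-- An infinite word is `R`-rich if its `R`-defect is zero. -/
def IsRich {A : Type*} (u : ℕ → A) : Prop :=
  wordDefect u = 0

/-- The generalized Thue–Morse word `t_{b,2}` over the alphabet `{0, 1} = ZMod 2`: its `n`-th
letter is the sum of the base-`b` digits of `n`, modulo `2`. -/
def thueMorse (b : ℕ) : ℕ → ZMod 2 :=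
  fun n => ((Nat.digits b n).sum : ZMod 2)

/-- The operation `S` on infinite binary words, `S(u₀u₁u₂…) = v₁v₂v₃…` with
`v_i = u_{i-1} + u_i mod 2`; the letter with index `n` (from zero) of the image is `v_{n+1}`. -/
def wordS (u : ℕ → ZMod 2) : ℕ → ZMod 2 :=
  fun n => u n + u (n + 1)

/-! ### Factors of infinite words -/

/-! A word is rich as soon as every nonempty factor has a palindromic suffix occurring only once in
it: each appended letter then contributes a new palindrome. Put `x m = v (m - 1)`. Carries at
multiples of `b` give `x m = 1` for `b ∤ m` and `x (b * m) = x m + b + 1`. For odd `b` this is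
constantly `1`; for even `b` it is a Toeplitz word, and `hasUnioccurrentPalSuffix_of_toeplitz`
obtains the suffix ending at `b * J + r` by lifting the one ending at `J`.

The complexity formula holds because the factors of `t` are closed under complement, which makes `S`
exactly two-to-one on them. -/

theorem length_factorAt {A : Type*} (u : ℕ → A) (i n : ℕ) : (factorAt u i n).length = n := by
  simp [factorAt]

theorem factorAt_eq_iff {A : Type*} (u v : ℕ → A) (i j n : ℕ) :
    factorAt u i n = factorAt v j n ↔ ∀ k < n, u (i + k) = v (j + k) := by
  unfold factorAt
  rw [List.ofFn_inj, funext_iff]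
  exact ⟨fun h k hk => h ⟨k, hk⟩, fun h k => h k k.2⟩

theorem factorAt_add {A : Type*} (u : ℕ → A) (i m n : ℕ) :
    factorAt u i (m + n) = factorAt u i m ++ factorAt u (i + m) n := by
  apply List.ext_getElem
  · simp [factorAt]
  · intro k h₁ h₂
    by_cases h : k < m
    · simp [factorAt, h]
    · have : i + m + (k - m) = i + k := by omega
      simp [factorAt, List.getElem_append, h, this]

theorem factorAt_infix {A : Type*} (u : ℕ → A) {i n k m : ℕ} (hik : i ≤ k)
    (hk : k + m ≤ i + n) : factorAt u k m <:+: factorAt u i n := by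
  obtain ⟨a, rfl⟩ := Nat.exists_eq_add_of_le hik
  obtain ⟨c, rfl⟩ : ∃ c, n = a + m + c := ⟨n - (a + m), by omega⟩
  exact ⟨factorAt u i a, factorAt u (i + (a + m)) c, by rw [factorAt_add, factorAt_add]⟩

theorem exists_eq_factorAt_of_infix {A : Type*} (u : ℕ → A) {i n : ℕ} {p : List A}
    (hp : p <:+: factorAt u i n) :
    ∃ k, i ≤ k ∧ k + p.length ≤ i + n ∧ p = factorAt u k p.length := by
  obtain ⟨s, t, h⟩ := hp
  have hlen := congrArg List.length h
  simp only [List.length_append, length_factorAt] at hlen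
  refine ⟨i + s.length, by omega, by omega, ?_⟩
  have hn : n = s.length + p.length + t.length := by omega
  rw [hn, factorAt_add, factorAt_add] at h
  have h' := (List.append_inj h (by simp [length_factorAt])).1
  exact (List.append_inj h' (by simp [length_factorAt])).2

theorem reverse_factorAt {A : Type*} (u : ℕ → A) {k m : ℕ}
    (h : ∀ a c, a + c + 1 = m → u (k + a) = u (k + c)) :
    (factorAt u k m).reverse = factorAt u k m := by
  apply List.ext_getElem
  · simp
  · intro a h₁ h₂
    simp only [length_factorAt] at h₂
    simp only [List.getElem_reverse, length_factorAt]
    simp only [factorAt, List.getElem_ofFn]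
    exact h _ _ (by omega)

/-! ### Unioccurrent palindromic suffixes and richness -/

/-- The word `u_i ⋯ u_j` has a palindromic suffix `u_k ⋯ u_j` that occurs only once in it. -/
def HasUnioccurrentPalSuffix {A : Type*} (u : ℕ → A) (i j : ℕ) : Prop :=
  ∃ k, i ≤ k ∧ k ≤ j ∧ (∀ a c, k ≤ a → k ≤ c → a + c = k + j → u a = u c) ∧
    ∀ s, i ≤ s → s < k → ∃ d, k + d ≤ j ∧ u (s + d) ≠ u (k + d)

theorem length_lt_ncard_palindromicFactors {A : Type*} (u : ℕ → A)
    (hu : ∀ i j, i ≤ j → HasUnioccurrentPalSuffix u i j) (i n : ℕ) :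
    n + 1 ≤ (palindromicFactors (factorAt u i n)).ncard := by
  induction n with
  | zero =>
    rw [Nat.succ_le_iff, Set.ncard_pos (palindromicFactors_finite _)]
    exact ⟨[], List.nil_infix, rfl⟩
  | succ n ih =>
    obtain ⟨k, hik, hkj, hpal, huni⟩ := hu i (i + n) (by omega)
    set p := factorAt u k (i + n + 1 - k) with hp
    have hpl : p.length = i + n + 1 - k := length_factorAt _ _ _
    have hnot : p ∉ palindromicFactors (factorAt u i n) := by
      rintro ⟨hinf, -⟩
      obtain ⟨s, his, hs, heq⟩ := exists_eq_factorAt_of_infix u hinf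
      rw [hpl] at hs heq
      obtain ⟨d, hd, hne⟩ := huni s his (by omega)
      rw [hp, factorAt_eq_iff] at heq
      exact hne (heq d (by omega)).symm
    have hsub : insert p (palindromicFactors (factorAt u i n)) ⊆
        palindromicFactors (factorAt u i (n + 1)) := by
      refine Set.insert_subset ⟨factorAt_infix u hik (by omega), ?_⟩ ?_
      · exact reverse_factorAt u fun a c hac => hpal _ _ (by omega) (by omega) (by omega)
      · rintro q ⟨hq, hq'⟩
        exact ⟨hq.trans (factorAt_infix u le_rfl (by omega)), hq'⟩
    have hcard := Set.ncard_le_ncard hsub (palindromicFactors_finite _)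
    rw [Set.ncard_insert_of_notMem hnot (palindromicFactors_finite _)] at hcard
    omega

theorem isRich_of_hasUnioccurrentPalSuffix {A : Type*} (u : ℕ → A)
    (hu : ∀ i j, i ≤ j → HasUnioccurrentPalSuffix u i j) : IsRich u := by
  apply le_antisymm
  · refine iSup₂_le fun w hw => ?_
    obtain ⟨n, i, rfl⟩ := hw
    have h := length_lt_ncard_palindromicFactors u hu i n
    have h' : finiteDefect (factorAt u i n) ≤ 0 := by
      unfold finiteDefect
      rw [length_factorAt]
      omega
    exact_mod_cast h'
  · have hmem : ([] : List A) ∈ wordLanguage u := ⟨0, 0, rfl⟩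
    have h0 : finiteDefect ([] : List A) = 0 := by
      have : palindromicFactors ([] : List A) = {[]} := by
        ext p
        simp only [palindromicFactors, Set.mem_ofPred_eq, List.infix_nil, Set.mem_singleton_iff]
        exact ⟨fun h => h.1, fun h => ⟨h, by rw [h]; rfl⟩⟩
      simp [finiteDefect, this]
    have := le_iSup₂ (f := fun w (_ : w ∈ wordLanguage u) => ((finiteDefect w : ℝ) : EReal))
      [] hmem
    rw [h0, Int.cast_zero, EReal.coe_zero] at this
    exact this

/-! ### Toeplitz words `x_m = 1` for `b ∤ m`, `x_{bm} = 1 + x_m` -/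

theorem zmod_two_eq_one_of_ne_zero {a : ZMod 2} (h : a ≠ 0) : a = 1 := by
  revert a; decide

/-- A palindrome on `[K, J]` lifts to one on `[b * K - r, b * J + r]`, since reflection preserves
divisibility by `b`. Zeros occur only at multiples of `b`, so they synchronise occurrences of the
lift; without zeros in it, a run of ones replaces it. -/
theorem hasUnioccurrentPalSuffix_of_toeplitz {b : ℕ} (hb : 2 ≤ b) {x : ℕ → ZMod 2}
    (hone : ∀ m, ¬ b ∣ m → x m = 1) (hmul : ∀ m, 1 ≤ m → x (b * m) = 1 + x m) (j : ℕ) :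
    ∀ i, 1 ≤ i → i ≤ j → HasUnioccurrentPalSuffix x i j := by
  have hzero : ∀ m, x m = 0 → b ∣ m := fun m hm => by
    by_contra h
    rw [hone m h] at hm
    exact one_ne_zero hm
  have hmul0 : ∀ m, 1 ≤ m → x (b * m) = 1 → x m = 0 := fun m hm h => by
    rw [hmul m hm] at h
    simpa using h
  induction j using Nat.strong_induction_on with
  | _ j IH =>
  intro i hi hij
  by_cases hz : ∃ z, i ≤ z ∧ z ≤ j ∧ x z = 0
  swap
  · have hx : ∀ a, i ≤ a → a ≤ j → x a = 1 := fun a h₁ h₂ =>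
      zmod_two_eq_one_of_ne_zero fun h => hz ⟨a, h₁, h₂, h⟩
    refine ⟨i, le_rfl, hij, fun a c ha hc hac => ?_, fun s h₁ h₂ => by omega⟩
    rw [hx a ha (by omega), hx c hc (by omega)]
  obtain ⟨J, r, hr, rfl⟩ : ∃ J r, r < b ∧ j = b * J + r :=
    ⟨j / b, j % b, Nat.mod_lt _ (by omega), (Nat.div_add_mod j b).symm⟩
  -- Here no lift fits in the window, whose only zero is at `b * J`. The last `r` ones suffice: any
  -- earlier start exceeds `b * J - r`, so the shifted block would cover that zero.
  by_cases hJ : b * J < i + r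
  · obtain ⟨z, hiz, hzj, hxz⟩ := hz
    obtain ⟨q, rfl⟩ := hzero z hxz
    have hqJ : q = J := by
      have h₁ : q < J + 1 := lt_of_mul_lt_mul_left (a := b) (by rw [mul_add]; omega) (by omega)
      have h₂ : J < q + 1 := lt_of_mul_lt_mul_left (a := b) (by rw [mul_add]; omega) (by omega)
      omega
    subst hqJ
    have hx : ∀ a, b * q + 1 ≤ a → a ≤ b * q + r → x a = 1 := fun a h₁ h₂ => by
      refine hone a fun ⟨m, hm⟩ => ?_
      subst hm
      have h₃ : q < m := lt_of_mul_lt_mul_left (a := b) (by omega) (by omega)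
      have h₄ : m < q + 1 := lt_of_mul_lt_mul_left (a := b) (by rw [mul_add]; omega) (by omega)
      omega
    rcases Nat.eq_zero_or_pos r with rfl | hr0
    · omega
    refine ⟨b * q + 1, by omega, by omega, fun a c ha hc hac => ?_, fun s h₁ h₂ => ?_⟩
    · rw [hx a ha (by omega), hx c hc (by omega)]
    · refine ⟨b * q - s, by omega, ?_⟩
      rw [show s + (b * q - s) = b * q by omega, hxz, hx _ (by omega) (by omega)]
      exact zero_ne_one
  push Not at hJ
  -- `I` is the first index with `i ≤ b * I - r`.
  obtain ⟨I, hI, hImin⟩ : ∃ I, i + r ≤ b * I ∧ ∀ m, i + r ≤ b * m → I ≤ m := by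
    have hex : ∃ I, i + r ≤ b * I := ⟨J, hJ⟩
    exact ⟨Nat.find hex, Nat.find_spec hex, fun m hm => Nat.find_min' hex hm⟩
  have hpos : ∀ m, i + r ≤ b * m → 1 ≤ m := fun m hm => by
    rcases Nat.eq_zero_or_pos m with rfl | h
    · simp at hm; omega
    · exact h
  have hIJ := hImin J hJ
  have hJ1 := hpos J hJ
  have hJlt : J < b * J + r := by
    have := Nat.mul_le_mul_right J hb
    omega
  obtain ⟨K, hIK, hKJ, hpal, huni⟩ := IH J hJlt I (hpos I hI) hIJ
  have hbIK : b * I ≤ b * K := Nat.mul_le_mul_left b hIK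
  have hbKJ : b * K ≤ b * J := Nat.mul_le_mul_left b hKJ
  by_cases hz' : ∃ z, b * K - r ≤ z ∧ z ≤ b * J + r ∧ x z = 0
  · obtain ⟨z, hz₁, hz₂, hxz⟩ := hz'
    refine ⟨b * K - r, by omega, by omega, fun a c ha hc hac => ?_, fun s h₁ h₂ => ?_⟩
    · have hac' : a + c = b * (K + J) := by rw [mul_add]; omega
      by_cases hba : b ∣ a
      · have hbc : b ∣ c := (Nat.dvd_add_right hba).1 ⟨_, hac'⟩
        obtain ⟨a, rfl⟩ := hba
        obtain ⟨c, rfl⟩ := hbc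
        have hsum : a + c = K + J :=
          Nat.eq_of_mul_eq_mul_left (by omega : 0 < b) (by rw [mul_add]; exact hac')
        have key : ∀ m, b * K - r ≤ b * m → K ≤ m := fun m hm => by
          have : K < m + 1 := lt_of_mul_lt_mul_left (a := b) (by rw [mul_add]; omega) (by omega)
          omega
        have hKa := key a ha
        have hKc := key c hc
        have hK1 := hpos K (by omega)
        rw [hmul a (by omega), hmul c (by omega), hpal a c hKa hKc hsum]
      · have hbc : ¬ b ∣ c := fun h => hba ((Nat.dvd_add_left h).1 ⟨_, hac'⟩)
        rw [hone a hba, hone c hbc]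
    · by_contra hcon
      push Not at hcon
      have hd := hcon (z - (b * K - r)) (by omega)
      rw [show b * K - r + (z - (b * K - r)) = z by omega, hxz] at hd
      -- A zero of the lift and its copy are both at multiples of `b`, so the shift is one too, and
      -- the earlier occurrence descends to one of `[K, J]` starting at `M` with `b * M = s + r`.
      have hdvd : b ∣ b * K - (s + r) := by
        have h := Nat.dvd_sub (hzero z hxz) (hzero _ hd)
        rwa [show z - (s + (z - (b * K - r))) = b * K - (s + r) by omega] at h
      obtain ⟨e, he⟩ := hdvd
      have heK : e ≤ K := le_of_mul_le_mul_left (a := b) (by omega) (by omega)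
      obtain ⟨M, rfl⟩ := Nat.exists_eq_add_of_le' heK
      rw [mul_add] at he h₂ hcon hbIK hbKJ
      have hs : b * M = s + r := by omega
      have he0 : 0 < e := by
        rcases Nat.eq_zero_or_pos e with rfl | h
        · simp at he; omega
        · exact h
      have hM1 := hpos M (by omega)
      obtain ⟨d, hdJ, hne⟩ := huni M (hImin M (by omega)) (by omega)
      apply hne
      have hbd := Nat.mul_le_mul_left b hdJ
      rw [mul_add, mul_add] at hbd
      have h := hcon (r + b * d) (by omega)
      rw [show s + (r + b * d) = b * (M + d) by rw [mul_add]; omega,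
        show b * M + b * e - r + (r + b * d) = b * (M + e + d) by
          rw [mul_add, mul_add]; omega,
        hmul _ (by omega), hmul _ (by omega)] at h
      exact add_left_cancel h
  · -- The lifted palindrome is a run of ones: use the whole final run of ones instead.
    have hx1 : ∀ a, b * K - r ≤ a → a ≤ b * J + r → x a = 1 := fun a h₁ h₂ =>
      zmod_two_eq_one_of_ne_zero fun h => hz' ⟨a, h₁, h₂, h⟩
    have hK1 := hpos K (by omega)
    have adj : ∀ m, x m = 0 → x (m + 1) = 0 → False := fun m h₁ h₂ => by
      have := (Nat.dvd_add_right (hzero m h₁)).1 (hzero _ h₂)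
      have := Nat.le_of_dvd one_pos this
      omega
    have hxJ : x J = 0 := hmul0 J hJ1 (hx1 _ (by omega) (by omega))
    have hxpred : x (J - 1) = 1 := by
      refine zmod_two_eq_one_of_ne_zero fun h => adj (J - 1) h ?_
      rwa [show J - 1 + 1 = J by omega]
    have hKeq : K = J := by
      by_contra hne
      have hle := Nat.mul_le_mul_left b (show K + 1 ≤ J by omega)
      rw [mul_add] at hle
      refine adj K (hmul0 K hK1 (hx1 _ (by omega) (by omega)))
        (hmul0 (K + 1) (by omega) (hx1 _ ?_ ?_)) <;> rw [mul_add] <;> omega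
    subst hKeq
    obtain ⟨z, hiz, hzj, hxz⟩ := hz
    obtain ⟨q, rfl⟩ := hzero z hxz
    have hqK : q + 1 ≤ K := by
      by_contra h
      have := Nat.mul_le_mul_left b (show K ≤ q by omega)
      have := hx1 (b * q) (by omega) hzj
      rw [hxz] at this
      exact zero_ne_one this
    obtain ⟨P, rfl⟩ := Nat.exists_eq_add_of_le' hK1
    have hbq := Nat.mul_le_mul_left b (show q ≤ P by omega)
    have hbP : b * (P + 1) = b * P + b := by ring
    have hP1 : 1 ≤ P := by
      rcases Nat.eq_zero_or_pos P with rfl | h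
      · rw [mul_zero] at hbq; omega
      · exact h
    have hxP : x (b * P) = 0 := by
      rw [hmul P hP1]
      simp only [Nat.add_sub_cancel] at hxpred
      rw [hxpred]
      decide
    have hx : ∀ a, b * P + 1 ≤ a → a ≤ b * (P + 1) + r → x a = 1 := fun a h₁ h₂ => by
      by_cases ha : b * (P + 1) - r ≤ a
      · exact hx1 a ha h₂
      · refine hone a fun ⟨m, hm⟩ => ?_
        subst hm
        have h₃ : P < m := lt_of_mul_lt_mul_left (a := b) (by omega) (by omega)
        have h₄ : m < P + 1 := lt_of_mul_lt_mul_left (a := b) (by omega) (by omega)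
        omega
    refine ⟨b * P + 1, by omega, by omega, fun a c ha hc hac => ?_, fun s h₁ h₂ => ?_⟩
    · rw [hx a ha (by omega), hx c hc (by omega)]
    · by_contra hcon
      push Not at hcon
      have hs : ∀ a, s ≤ a → a < s + b + r → x a = 1 := fun a h₃ h₄ => by
        have h := hcon (a - s) (by omega)
        rw [show s + (a - s) = a by omega] at h
        exact h.trans (hx _ (by omega) (by omega))
      have hlt : s + b + r ≤ b * P := by
        by_contra h
        have := hs (b * P) (by omega) (by omega)
        rw [hxP] at this
        exact zero_ne_one this
      -- Another run of `b + r` ones contains such a `b * m` among its last `b` positions, forcing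
      -- `x m = 0` with `I ≤ m < J`; but the suffix `[J, J]`, the single letter `0`, is
      -- unioccurrent.
      obtain ⟨m, hm₁, hm₂⟩ : ∃ m, s + r ≤ b * m ∧ b * m < s + r + b := by
        refine ⟨(s + r + b - 1) / b, ?_, ?_⟩
        · have := Nat.div_add_mod (s + r + b - 1) b
          have := Nat.mod_lt (s + r + b - 1) (show 0 < b by omega)
          omega
        · have := Nat.mul_div_le (s + r + b - 1) b
          omega
      have hm1 := hpos m (by omega)
      have hmP : m < P + 1 := lt_of_mul_lt_mul_left (a := b) (by omega) (by omega)
      have hxm : x m = 0 := hmul0 m hm1 (hs _ (by omega) (by omega))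
      obtain ⟨d, hd, hne⟩ := huni m (hImin m (by omega)) hmP
      obtain rfl : d = 0 := by omega
      exact hne (hxm.trans hxJ.symm)

/-! ### The generalized Thue–Morse word -/

theorem thueMorse_mul_add {b : ℕ} (hb : 2 ≤ b) (q : ℕ) {r : ℕ} (hr : r < b) :
    thueMorse b (b * q + r) = thueMorse b q + r := by
  unfold thueMorse
  by_cases h : r = 0 ∧ q = 0
  · obtain ⟨rfl, rfl⟩ := h
    simp
  · rw [add_comm (b * q), Nat.digits_add b (by omega) r q hr (by omega)]
    push_cast [List.sum_cons]
    ring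

theorem wordS_thueMorse_eq_one {b : ℕ} (hb : 2 ≤ b) {n : ℕ} (h : ¬ b ∣ n + 1) :
    wordS (thueMorse b) n = 1 := by
  have hlt := Nat.mod_lt n (show 0 < b by omega)
  have hn := Nat.div_add_mod n b
  have hr : n % b + 1 < b := by
    by_contra hcon
    exact h ⟨n / b + 1, by rw [mul_add]; omega⟩
  unfold wordS
  rw [← hn, add_assoc (b * (n / b)), thueMorse_mul_add hb _ hlt, thueMorse_mul_add hb _ hr]
  push_cast
  linear_combination CharTwo.add_self_eq_zero (thueMorse b (n / b) + ((n % b : ℕ) : ZMod 2))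

theorem wordS_thueMorse_mul {b : ℕ} (hb : 2 ≤ b) (m : ℕ) :
    wordS (thueMorse b) (b * (m + 1) - 1) = wordS (thueMorse b) m + b + 1 := by
  unfold wordS
  rw [show b * (m + 1) - 1 + 1 = b * (m + 1) + 0 by rw [mul_add]; omega,
    show b * (m + 1) - 1 = b * m + (b - 1) by rw [mul_add]; omega,
    thueMorse_mul_add hb _ (by omega), thueMorse_mul_add hb _ (by omega),
    Nat.cast_sub (by omega)]
  push_cast
  linear_combination -(CharTwo.add_self_eq_zero (1 : ZMod 2))

theorem wordS_thueMorse_of_odd {b : ℕ} (hb : 2 ≤ b) (hodd : Odd b) (n : ℕ) :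
    wordS (thueMorse b) n = 1 := by
  induction n using Nat.strong_induction_on with
  | _ n IH =>
  by_cases h : b ∣ n + 1
  · obtain ⟨m, hm⟩ := h
    obtain ⟨m, rfl⟩ : ∃ k, m = k + 1 := Nat.exists_eq_succ_of_ne_zero (by rintro rfl; simp at hm)
    have hlt : m < n := by
      have := Nat.mul_le_mul_right (m + 1) hb
      omega
    rw [show n = b * (m + 1) - 1 by omega, wordS_thueMorse_mul hb, IH m hlt,
      (ZMod.natCast_eq_one_iff_odd).2 hodd]
    decide
  · exact wordS_thueMorse_eq_one hb h

theorem isRich_wordS_thueMorse {b : ℕ} (hb : 2 ≤ b) : IsRich (wordS (thueMorse b)) := by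
  apply isRich_of_hasUnioccurrentPalSuffix
  intro i j hij
  rcases Nat.even_or_odd b with heven | hodd
  -- Indices shift by one; the junk value at `m = 0` is harmless, as `b ∣ 0` and windows start at
  -- `1` or later.
  · have hT := hasUnioccurrentPalSuffix_of_toeplitz hb
      (x := fun m => wordS (thueMorse b) (m - 1)) (fun m hm => ?_) (fun m hm => ?_)
      (j + 1) (i + 1) (by omega) (by omega)
    · obtain ⟨k, hik, hkj, hpal, huni⟩ := hT
      refine ⟨k - 1, by omega, by omega, fun a c ha hc hac => ?_, fun s h₁ h₂ => ?_⟩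
      · exact hpal (a + 1) (c + 1) (by omega) (by omega) (by omega)
      · obtain ⟨d, hd, hne⟩ := huni (s + 1) (by omega) (by omega)
        refine ⟨d, by omega, ?_⟩
        simp only [show s + 1 + d - 1 = s + d by omega,
          show k + d - 1 = k - 1 + d by omega] at hne
        exact hne
    · apply wordS_thueMorse_eq_one hb
      rcases Nat.eq_zero_or_pos m with rfl | h
      · simp at hm
      · rwa [Nat.sub_add_cancel h]
    · obtain ⟨m, rfl⟩ := Nat.exists_eq_add_of_le' hm
      simp only [wordS_thueMorse_mul hb, (ZMod.natCast_eq_zero_iff_even).2 heven,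
        Nat.add_sub_cancel]
      ring
  · refine ⟨i, le_rfl, hij, fun a c _ _ _ => ?_, fun s _ _ => by omega⟩
    rw [wordS_thueMorse_of_odd hb hodd, wordS_thueMorse_of_odd hb hodd]

/-! ### Factor complexity of `wordS` -/

/-- Adding `b ^ k` puts a digit `1` in an empty position, without carry. -/
theorem thueMorse_add_pow {b : ℕ} (hb : 2 ≤ b) (k : ℕ) :
    ∀ n, n < b ^ k → thueMorse b (n + b ^ k) = thueMorse b n + 1 := by
  induction k with
  | zero =>
    intro n hn
    obtain rfl : n = 0 := by simpa using hn
    have := thueMorse_mul_add hb 0 (r := 1) (by omega)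
    simpa using this
  | succ k ih =>
    intro n hn
    have hlt := Nat.mod_lt n (show 0 < b by omega)
    have hq : n / b < b ^ k := Nat.div_lt_of_lt_mul (by rwa [pow_succ'] at hn)
    have hn' := thueMorse_mul_add hb (n / b) hlt
    have hs := thueMorse_mul_add hb (n / b + b ^ k) hlt
    rw [Nat.div_add_mod] at hn'
    have e : b * (n / b + b ^ k) + n % b = n + b ^ (k + 1) := by
      have := Nat.div_add_mod n b
      rw [mul_add, pow_succ']
      omega
    rw [e, ih _ hq] at hs
    rw [hs, hn']
    ring

theorem exists_complement_factor_thueMorse {b : ℕ} (hb : 2 ≤ b) (i n : ℕ) :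
    ∃ j, ∀ k < n, thueMorse b (j + k) = thueMorse b (i + k) + 1 := by
  refine ⟨i + b ^ (i + n), fun k hk => ?_⟩
  have h : i + k < b ^ (i + n) :=
    (show i + k < i + n by omega).trans (Nat.lt_pow_self (by omega))
  rw [← thueMorse_add_pow hb _ _ h]
  congr 1
  omega

theorem zipWith_tail_factorAt (u : ℕ → ZMod 2) (i n : ℕ) :
    List.zipWith (· + ·) (factorAt u i (n + 1)) (factorAt u i (n + 1)).tail =
      factorAt (wordS u) i n := by
  apply List.ext_getElem
  · simp [factorAt]
  · intro k h₁ h₂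
    simp only [factorAt, List.getElem_zipWith, List.getElem_tail, List.getElem_ofFn, wordS,
      add_assoc]

theorem eq_of_wordS_eq (u : ℕ → ZMod 2) {i j n : ℕ} (h0 : u i = u j)
    (h : ∀ k < n, wordS u (i + k) = wordS u (j + k)) :
    ∀ k < n + 1, u (i + k) = u (j + k) := by
  intro k
  induction k with
  | zero => intro _; exact h0
  | succ k ih =>
    intro hk
    have h₁ := h k (by omega)
    unfold wordS at h₁
    rw [ih (by omega)] at h₁
    exact add_left_cancel h₁

/-- A factor is recovered from its first letter and its image under `S`; complementing flips the
former and fixes the latter, so all such pairs occur. -/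
theorem factorComplexity_eq_two_mul (u : ℕ → ZMod 2)
    (hu : ∀ i n, ∃ j, ∀ k < n, u (j + k) = u (i + k) + 1) (n : ℕ) :
    factorComplexity u (n + 1) = 2 * factorComplexity (wordS u) n := by
  let F : List (ZMod 2) → ZMod 2 × List (ZMod 2) :=
    fun w => (w.headD 0, List.zipWith (· + ·) w w.tail)
  have hF : ∀ i, F (factorAt u i (n + 1)) = (u i, factorAt (wordS u) i n) := fun i =>
    Prod.ext (by simp [F, factorAt, List.ofFn_succ]) (zipWith_tail_factorAt u i n)
  have hinj : Set.InjOn F (factorsOfLength u (n + 1)) := by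
    rintro _ ⟨i, rfl⟩ _ ⟨j, rfl⟩ hij
    rw [hF, hF, Prod.mk.injEq, factorAt_eq_iff] at hij
    rw [factorAt_eq_iff]
    exact eq_of_wordS_eq u hij.1 hij.2
  have himg : F '' factorsOfLength u (n + 1) =
      (Set.univ : Set (ZMod 2)) ×ˢ factorsOfLength (wordS u) n := by
    ext ⟨a, w⟩
    constructor
    · rintro ⟨_, ⟨i, rfl⟩, h⟩
      rw [hF, Prod.mk.injEq] at h
      exact ⟨Set.mem_univ _, i, h.2.symm⟩
    · rintro ⟨-, i, hw⟩
      obtain rfl : w = factorAt (wordS u) i n := hw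
      by_cases ha : a = u i
      · exact ⟨_, ⟨i, rfl⟩, by rw [hF, ha]⟩
      · obtain ⟨j, hj⟩ := hu i (n + 1)
        refine ⟨_, ⟨j, rfl⟩, ?_⟩
        rw [hF, Prod.mk.injEq, factorAt_eq_iff]
        constructor
        · have h0 := hj 0 (by omega)
          simp only [add_zero] at h0
          rw [h0]
          generalize u i = c at ha
          revert a c
          decide
        · intro k hk
          unfold wordS
          have h₁ := hj (k + 1) (by omega)
          rw [← add_assoc, ← add_assoc] at h₁
          rw [hj k (by omega), h₁]
          linear_combination CharTwo.add_self_eq_zero (1 : ZMod 2)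
  unfold factorComplexity
  rw [← hinj.ncard_image, himg, Set.ncard_prod, Set.ncard_univ, Nat.card_zmod]

theorem mainTheorem6 (b : ℕ) (hb : 2 ≤ b) :
    IsRich (wordS (thueMorse b)) ∧
      ∀ n : ℕ, (factorComplexity (wordS (thueMorse b)) n : ℚ) =
        (factorComplexity (thueMorse b) (n + 1) : ℚ) / 2 := by
  refine ⟨isRich_wordS_thueMorse hb, fun n => ?_⟩
  rw [factorComplexity_eq_two_mul _ (exists_complement_factor_thueMorse hb) n]
  push_cast
  ring
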